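/- **Setting.** Let $N, L, \Lambda, D \in \mathbb{N}$ with $1 \le \Lambda \le N$, and let $L_C, L_F \in \mathbb{N}_0$ (context and forecast length) satisfy $L_C + L_F \ge 1$ and $L - L_F + 1 \ge L_C + L_F$. Let $C > 0$ be a clipping norm, $\sigma, \sigma_C, \sigma_F, v \ge 0$, $\eta \in \mathbb{R}$ and $\theta \in \mathbb{R}^D$. $\mathcal{N}(\mu, s)$ denotes the normal distribution with mean $\mu$ and standard deviation $s$. Let $f_\theta$ be a model and $\mathcal{L}$ a loss such that $g(y_C, y_F) = \nabla_\theta \mathcal{L}(f_\theta(y_C), y_F) \in \mathbb{R}^D$ is a measurable function of $(y_C, y_F) \in \mathbb{R}^{L_C} \times \mathbb{R}^{L_F}$. A dataset is a family $x = (x_1, \dots, x_N)$ of series $x_n \in \mathbb{R}^L$. Write $x \simeq_{1,v} x'$ ($(1,v)$-event-level neighbors) if $x$ and $x'$ differ in at most one series, there in at most one time step, and there by at most $v$ in absolute value. For a dataset $x$, let $\hat M_x$ be the distribution of the output $\theta - \eta \tilde g$ of one augmented training step with $\lambda = 1$ subsequence per selected series: 1. (top-level sampling without replacement) draw a uniformly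 random permutation $\pi$ of $\{1,\dots,N\}$ and select the $\lfloor \Lambda/\lambda \rfloor = \Lambda$ series $x_{\pi(1)}, \dots, x_{\pi(\Lambda)}$; 2. (bottom-level sampling with replacement) prepend $L_C$ zeros to each selected series, draw independently for each of them a start index $t$ uniformly from $\{1, \dots, L - L_F + 1\}$, and split the elements $t, \dots, t + L_C + L_F - 1$ of the padded series into a context window $y_{C,i}$ (first $L_C$ elements) and a forecast window $y_{F,i}$ (last $L_F$ elements); 3. (augmentation) put $g_i = g(y_{C,i} + Z_{C,i},\, y_{F,i} + Z_{F,i})$ with independent $Z_{C,i} \sim \mathcal{N}(0, \sigma_C^2 v^2 I)$ and $Z_{F,i} \sim \mathcal{N}(0, \sigma_F^2 v^2 I)$; 4. (clipping and noise) put $\tilde g = \frac{1}{\Lambda}\Big(\sum_{i=1}^{\Lambda} \frac{g_i}{\max\{1, \|g_i\|_2 / C\}} + Z\Big)$ with independent $Z \sim \mathcal{N}(0, \sigma^2 C^2 I)$. For $\alpha \ge 0$ and probability measures $P, Q$, let $H_\alpha(P\|Q) = \int \max\{\frac{dP}{dQ} - \alpha, 0\}\, dQ + P_s(\text{whole space})$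 be the hockey-stick divergence, where $\frac{dP}{dQ}$ is the density of the absolutely continuous part of $P$ with respect to $Q$ and $P_s$ is the singular part of $P$. Let $\mathrm{TVD}(P,Q) = H_1(P\|Q)$. **Theorem.** Let $$ r = \frac{L_C + L_F}{L - L_F + 1}, \qquad \rho = \frac{\lfloor \Lambda/\lambda\rfloor}{N} = \frac{\Lambda}{N}, \qquad \phi = \frac{L_F}{L_C + L_F}, $$ $$ p_2 = \rho\, r\, \phi\, \mathrm{TVD}\big(\mathcal{N}(0,\sigma_F), \mathcal{N}(1,\sigma_F)\big) + \rho\, r\, (1-\phi)\, \mathrm{TVD}\big(\mathcal{N}(0,\sigma_C), \mathcal{N}(1,\sigma_C)\big). $$ Then $p_2 \in [0,1]$, and with $\hat P(1) = (1-p_2)\,\mathcal{N}(0,\sigma) + p_2\,\mathcal{N}(2,\sigma)$ the per-step privacy profile $\hat H(\alpha) = \sup_{x \simeq_{1,v} x'} H_\alpha(\hat M_x \| \hat M_{x'})$ fulfills, for all $\alpha \ge 0$, $$ \hat H(\alpha) \le \begin{cases} H_\alpha\big(\hat P(1) \,\|\, \mathcal{N}(0,\sigma)\big) & \text{if } \alpha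 \ge 1,\\ H_\alpha\big(\mathcal{N}(0,\sigma) \,\|\, \hat P(1)\big) & \text{if } 0 \le \alpha < 1. \end{cases} $$ -/

import Mathlib

open MeasureTheory ProbabilityTheory
open scoped NNReal ENNReal

noncomputable section

namespace DPForecast

/-- Hockey-stick divergence `H_α(P ‖ Q) = ∫ max (dP/dQ - α, 0) dQ`. The part of `P` that is
singular with respect to `Q` (where `dP/dQ = ∞`) contributes its full mass, as is standard for
`f`-divergences; it vanishes when `P ≪ Q`. Subtraction in `ℝ≥0∞` is truncated at `0`. -/
def hockeyStick {E : Type*} [MeasurableSpace E] (α : ℝ≥0) (P Q : Measure E) : ℝ≥0∞ :=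
  ∫⁻ o, (P.rnDeriv Q o - α) ∂Q + P.singularPart Q Set.univ

/-- Total variation distance, `TVD(P, Q) = H_1(P ‖ Q)`. -/
def tvd {E : Type*} [MeasurableSpace E] (P Q : Measure E) : ℝ :=
  (hockeyStick 1 P Q).toReal

/-- The univariate normal distribution with mean `μ` and standard deviation `s`. -/
def normal (μ : ℝ) (s : ℝ≥0) : Measure ℝ := gaussianReal μ (s ^ 2)

/-- The mixture of Gaussians with means `μ`, weights `p` and common standard deviation `s`. -/
def mixtureOfGaussians {K : ℕ} (μ p : Fin K → ℝ) (s : ℝ≥0) : Measure ℝ :=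
  ∑ k, ENNReal.ofReal (p k) • normal (μ k) s

/-- Datasets of `N` real time series of length `L`. -/
abbrev Dataset (N L : ℕ) : Type := Fin N → Fin L → ℝ

/-- `(w, v)`-event-level neighbouring datasets: they differ at most in one series, there only
inside a range of `w` consecutive time steps, and there by at most `v` per step. -/
def EventNeighboring {N L : ℕ} (w : ℕ) (v : ℝ≥0) (x x' : Dataset N L) : Prop :=
  ∃ n : Fin N, (∀ m, m ≠ n → x m = x' m) ∧
    (∃ t : Fin L, ∀ i : Fin L, ¬ ((t : ℕ) ≤ i ∧ (i : ℕ) < t + w) → x n i = x' n i) ∧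
    ∀ i, |x n i - x' n i| ≤ v

/-- The series `a` after prepending `L_C` zeros, with positions counted from `0`. -/
def prependZeros {L : ℕ} (L_C : ℕ) (a : Fin L → ℝ) (k : ℕ) : ℝ :=
  if h : L_C ≤ k ∧ k - L_C < L then a ⟨k - L_C, h.2⟩ else 0

/-- Context window of the length `L_C + L_F` subsequence of the padded series that starts at
(`0`-based) position `t`. -/
def contextWindow {L : ℕ} (L_C : ℕ) (a : Fin L → ℝ) (t : ℕ) : Fin L_C → ℝ :=
  fun k => prependZeros L_C a (t + k)

/-- Forecast window of the length `L_C + L_F` subsequence of the padded series that starts at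
(`0`-based) position `t`. -/
def forecastWindow {L : ℕ} (L_C L_F : ℕ) (a : Fin L → ℝ) (t : ℕ) : Fin L_F → ℝ :=
  fun k => prependZeros L_C a (t + L_C + k)

/-- Clipping a gradient to norm `C`: `g / max {1, ‖g‖ / C}`. -/
def clip {D : ℕ} (C : ℝ≥0) (g : EuclideanSpace ℝ (Fin D)) : EuclideanSpace ℝ (Fin D) :=
  (max 1 (‖g‖ / C))⁻¹ • g

/-- The mixture, over a uniformly distributed `i : ι`, of the measures `κ i`. -/
def uniformMixture {ι E : Type*} [Fintype ι] [MeasurableSpace E] (κ : ι → Measure E) :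
    Measure E :=
  (Fintype.card ι : ℝ≥0∞)⁻¹ • ∑ i, κ i

/-- Hyperparameters of the training procedure. -/
structure Params where
  /-- number of series in the dataset -/
  N : ℕ
  /-- length of each series -/
  L : ℕ
  /-- context length -/
  L_C : ℕ
  /-- forecast length -/
  L_F : ℕ
  /-- number `λ` of subsequences drawn from each selected series -/
  lam : ℕ
  /-- batch size `Λ` -/
  Lam : ℕ
  /-- number of model parameters -/
  D : ℕ
  /-- learning rate -/
  η : ℝ
  /-- clipping norm -/
  C : ℝ≥0
  /-- gradient noise scale -/
  σ : ℝ≥0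
  /-- context augmentation noise scale -/
  σ_C : ℝ≥0
  /-- forecast augmentation noise scale -/
  σ_F : ℝ≥0
  /-- maximal magnitude of change of a single value -/
  v : ℝ≥0

namespace Params

variable (c : Params)

/-- The space of model parameters. -/
abbrev Theta : Type := EuclideanSpace ℝ (Fin c.D)

/-- The number `T = L - L_F + 1` of admissible start positions of a subsequence. -/
abbrev T : ℕ := c.L - c.L_F + 1

/-- The number `⌊Λ / λ⌋` of series selected in one step. -/
abbrev topSize : ℕ := c.Lam / c.lam

/-- The positions of a random permutation of the series that enter the batch. -/
abbrev Slot : Type := {n : Fin c.N // (n : ℕ) < c.topSize}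

/-- Augmentation noise for one subsequence: a pair of noise vectors for context and forecast. -/
abbrev AugNoise : Type := (Fin c.L_C → ℝ) × (Fin c.L_F → ℝ)

/-- `Z_C ∼ N(0, σ_C² v² I)` and `Z_F ∼ N(0, σ_F² v² I)`, independent. -/
def augLaw : Measure c.AugNoise :=
  (Measure.pi fun _ => normal 0 (c.σ_C * c.v)).prod
    (Measure.pi fun _ => normal 0 (c.σ_F * c.v))

/-- Joint law of the noise of one step: independent augmentation noise for each subsequence in
the batch, and an independent standard Gaussian vector for the gradient perturbation. -/
def noiseLaw : Measure ((c.Slot → Fin c.lam → c.AugNoise) × c.Theta) :=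
  (Measure.pi fun _ => Measure.pi fun _ => c.augLaw).prod (stdGaussian c.Theta)

/-- Output `θ - η g̃` of the augmented noisy training step with per-subsequence gradient function
`g`, on data `x`, given the random permutation `π`, the start positions `t` and the noise
`z = (Z, G)`. Here `g̃ = Λ⁻¹ (∑ clip (g (y_C + Z_C, y_F + Z_F)) + σ C G)`. -/
def stepOutput (g : (Fin c.L_C → ℝ) × (Fin c.L_F → ℝ) → c.Theta) (θ : c.Theta)
    (x : Dataset c.N c.L) (π : Equiv.Perm (Fin c.N)) (t : c.Slot → Fin c.lam → Fin c.T)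
    (z : (c.Slot → Fin c.lam → c.AugNoise) × c.Theta) : c.Theta :=
  θ - c.η • ((c.Lam : ℝ)⁻¹ •
    ((∑ n : c.Slot, ∑ j : Fin c.lam,
        clip c.C (g (contextWindow c.L_C (x (π n)) (t n j) + (z.1 n j).1,
          forecastWindow c.L_C c.L_F (x (π n)) (t n j) + (z.1 n j).2)))
      + ((c.σ * c.C : ℝ≥0) : ℝ) • z.2))

/-- Output distribution of a single training step: top-level sampling without replacement (the
first `⌊Λ / λ⌋` entries of a uniformly random permutation), bottom-level sampling with replacement
(`λ` independent uniform start positions for each selected series), and Gaussian augmentation. -/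
def stepLaw (g : (Fin c.L_C → ℝ) × (Fin c.L_F → ℝ) → c.Theta) (θ : c.Theta)
    (x : Dataset c.N c.L) : Measure c.Theta :=
  uniformMixture fun π : Equiv.Perm (Fin c.N) =>
    uniformMixture fun t : c.Slot → Fin c.lam → Fin c.T =>
      c.noiseLaw.map (c.stepOutput g θ x π t)

/-- The gradient `∇_θ 𝓛(f_θ(y_C), y_F)` of the loss of model `f` at parameters `θ`, as a function
of the pair `(y_C, y_F)`. -/
def lossGradient {O : Type*} (f : c.Theta → (Fin c.L_C → ℝ) → O)
    (loss : O → (Fin c.L_F → ℝ) → ℝ) (θ : c.Theta) :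
    (Fin c.L_C → ℝ) × (Fin c.L_F → ℝ) → c.Theta :=
  fun y => gradient (fun ϑ => loss (f ϑ y.1) y.2) θ

/-- Per-step privacy profile of the augmented training step under `(w, v)`-event-level privacy:
the supremum of `H_α(M_x ‖ M_x')` over all neighbouring `x`, `x'`. -/
def privacyProfile {O : Type*} (f : c.Theta → (Fin c.L_C → ℝ) → O)
    (loss : O → (Fin c.L_F → ℝ) → ℝ) (θ : c.Theta) (w : ℕ) (α : ℝ≥0) : ℝ≥0∞ :=
  ⨆ (x : Dataset c.N c.L) (x' : Dataset c.N c.L) (_ : EventNeighboring w c.v x x'),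
    hockeyStick α (c.stepLaw (c.lossGradient f loss θ) θ x)
      (c.stepLaw (c.lossGradient f loss θ) θ x')

end Params

end DPForecast

end

open DPForecast

open DPForecast

namespace DPForecast

/-! ### Hockey-stick divergence as an inequality between tests -/

section HockeyStick

variable {E : Type*} [MeasurableSpace E]

/-! A bound `H_α(P ‖ Q) ≤ ε` amounts to `P A ≤ α Q A + ε` for every event `A`, so an event in
parameter space is fixed and only its probability is tracked.

Given the windows of all other series, group the permutations into families of `N` that differ by
the position `k` of the changed series `n` (`sum_perm_eq_sum_swap`). Within a family the batches
share all but one entry (`sum_slot_swap`), so the sum of clipped gradients is `w + R` with `R` fixed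
and `‖w‖ ≤ C`. Let `h w` be the probability of the event given the sum `w + R`, and let `S`, `s` be
the supremum and infimum of `h` over the ball. The family averages `Φ`, `Φ'` under the two datasets
lie in `[s, S]`. They differ only through positions inside the batch (a fraction `ρ`), and there by
at most the total variation between the two window laws (`lintegral_windowLaw_le`) times `S - s`.
Hence `Φ ≤ Φ' + p₂ (S - s)`.

Any two sums `w + R` are at distance at most `2C`, so two values of `h` are the powers of a single
test under `N(0, σ)` and `N(2, σ)` (`exists_gaussian_test`), whatever the dimension. The
one-dimensional divergence with mixture weight `p₂` therefore yields a linear inequality between `S`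
and `s`, which together with the oscillation bound gives `Φ ≤ α Φ' + ε`
(`le_mul_add_of_oscillation`). Averaging over families and over the other windows preserves this
inequality. -/

theorem lintegral_le_of_hockeyStick {P Q : Measure E} [P.HaveLebesgueDecomposition Q] (α : ℝ≥0)
    {ψ : E → ℝ≥0∞} (hψ : Measurable ψ) {B : ℝ≥0∞} (hB : ∀ e, ψ e ≤ B) :
    ∫⁻ e, ψ e ∂P ≤ α * ∫⁻ e, ψ e ∂Q + B * hockeyStick α P Q := by
  have hd := Measure.measurable_rnDeriv P Q
  conv_lhs => rw [← Measure.rnDeriv_add_singularPart P Q]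
  rw [lintegral_add_measure, lintegral_withDensity_eq_lintegral_mul _ hd hψ]
  have h1 : ∫⁻ e, (P.rnDeriv Q * ψ) e ∂Q
      ≤ α * ∫⁻ e, ψ e ∂Q + B * ∫⁻ e, (P.rnDeriv Q e - α) ∂Q := by
    rw [← lintegral_const_mul _ hψ, ← lintegral_const_mul _ (hd.sub_const _),
      ← lintegral_add_left (hψ.const_mul _)]
    refine lintegral_mono fun e => ?_
    calc P.rnDeriv Q e * ψ e ≤ (α + (P.rnDeriv Q e - α)) * ψ e := by
          gcongr; exact le_add_tsub
      _ ≤ α * ψ e + B * (P.rnDeriv Q e - α) := by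
          rw [add_mul, mul_comm (_ - _)]; gcongr; exact hB e
  have h2 : ∫⁻ e, ψ e ∂(P.singularPart Q) ≤ B * P.singularPart Q Set.univ := by
    rw [← lintegral_const]; exact lintegral_mono hB
  calc _ ≤ _ := add_le_add h1 h2
    _ = _ := by rw [hockeyStick, mul_add, add_assoc]

/-- One event attains the divergence, as in the Neyman–Pearson lemma. -/
theorem hockeyStick_le_of_forall {P Q : Measure E} [P.HaveLebesgueDecomposition Q]
    [IsFiniteMeasure Q] (α : ℝ≥0) {ε : ℝ≥0∞}
    (h : ∀ A, MeasurableSet A → P A ≤ α * Q A + ε) : hockeyStick α P Q ≤ ε := by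
  have hd := Measure.measurable_rnDeriv P Q
  obtain ⟨S, hS, hPS, hQS⟩ := Measure.mutuallySingular_singularPart P Q
  set R : Set E := {e | (α : ℝ≥0∞) ≤ P.rnDeriv Q e}
  have hR : MeasurableSet R := measurableSet_le measurable_const hd
  -- `Sᶜ` is `Q`-null and carries the singular part, so adding it to `R` captures that mass without
  -- increasing `Q A`.
  set A : Set E := R ∪ Sᶜ
  have hA : MeasurableSet A := hR.union hS.compl
  have hQA : Q A = Q R := by
    refine le_antisymm ((measure_union_le _ _).trans ?_) (measure_mono Set.subset_union_left)
    rw [hQS, add_zero]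
  have h1 : ∫⁻ e, (P.rnDeriv Q e - α) ∂Q + α * Q A = ∫⁻ e in R, P.rnDeriv Q e ∂Q := by
    have : ∫⁻ e, (P.rnDeriv Q e - α) ∂Q = ∫⁻ e in R, (P.rnDeriv Q e - α) ∂Q := by
      refine (setLIntegral_eq_of_support_subset fun e he => ?_).symm
      by_contra hc
      exact he (tsub_eq_zero_of_le (not_le.1 hc).le)
    rw [this, hQA, ← setLIntegral_const, ← lintegral_add_right _ measurable_const]
    refine setLIntegral_congr_fun hR fun e he => ?_
    exact tsub_add_cancel_of_le he
  have h2 : P.singularPart Q Set.univ ≤ P.singularPart Q A := by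
    rw [← Set.union_compl_self S]
    refine (measure_union_le _ _).trans ?_
    rw [hPS, zero_add]
    exact measure_mono Set.subset_union_right
  have h3 : ∫⁻ e in R, P.rnDeriv Q e ∂Q + P.singularPart Q A ≤ P A := by
    conv_rhs => rw [← Measure.rnDeriv_add_singularPart P Q]
    rw [Measure.add_apply, withDensity_apply _ hA]
    gcongr
    exact Set.subset_union_left
  have hfin : (α : ℝ≥0∞) * Q A ≠ ⊤ := ENNReal.mul_ne_top ENNReal.coe_ne_top (measure_ne_top _ _)
  rw [← ENNReal.add_le_add_iff_right hfin, hockeyStick]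
  calc _ = (∫⁻ e, (P.rnDeriv Q e - α) ∂Q + α * Q A) + P.singularPart Q Set.univ := by ring
    _ ≤ P A := by rw [h1]; exact (add_le_add_right h2 _).trans h3
    _ ≤ _ := (h A hA).trans (by rw [add_comm])

theorem ofReal_tvd (P Q : Measure E) [IsProbabilityMeasure P] [IsProbabilityMeasure Q] :
    ENNReal.ofReal (tvd P Q) = hockeyStick 1 P Q :=
  ENNReal.ofReal_toReal <| ne_top_of_le_ne_top ENNReal.one_ne_top <|
    hockeyStick_le_of_forall 1 fun _ _ => prob_le_one.trans le_add_self

theorem tvd_le_one (P Q : Measure E) [IsProbabilityMeasure P] [IsProbabilityMeasure Q] :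
    tvd P Q ≤ 1 := by
  rw [← ENNReal.ofReal_le_ofReal_iff zero_le_one, ofReal_tvd, ENNReal.ofReal_one]
  exact hockeyStick_le_of_forall 1 fun _ _ => prob_le_one.trans le_add_self

theorem tvd_nonneg (P Q : Measure E) : 0 ≤ tvd P Q := ENNReal.toReal_nonneg

end HockeyStick

/-! ### Product measures: resampling one coordinate, injective reindexing -/

section Product

theorem measurable_update_prod {ι : Type*} [DecidableEq ι] {E : Type*} [MeasurableSpace E]
    (n : ι) :
    Measurable fun q : (ι → E) × E => Function.update q.1 n q.2 := by
  refine measurable_pi_iff.2 fun i => ?_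
  by_cases h : i = n
  · subst h; simpa using measurable_snd
  · simp only [Function.update_of_ne h]; fun_prop

variable {ι : Type*} [Fintype ι] [DecidableEq ι] {E : Type*} [MeasurableSpace E]

theorem map_update_prod_pi (ν : ι → Measure E) [∀ i, IsProbabilityMeasure (ν i)] (n : ι)
    (κ : Measure E) [IsProbabilityMeasure κ] :
    ((Measure.pi ν).prod κ).map (fun q => Function.update q.1 n q.2)
      = Measure.pi (Function.update ν n κ) := by
  have hprob : ∀ i, IsProbabilityMeasure (Function.update ν n κ i) := by
    intro i
    by_cases h : i = n
    · subst h; simpa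
    · simpa [h] using inferInstanceAs (IsProbabilityMeasure (ν i))
  have hm := measurable_update_prod (E := E) n
  refine (Measure.pi_eq fun s hs => ?_).symm
  rw [Measure.map_apply hm (MeasurableSet.univ_pi hs)]
  have hpre : (fun q : (ι → E) × E => Function.update q.1 n q.2) ⁻¹' Set.univ.pi s
      = (Set.univ.pi (Function.update s n Set.univ)) ×ˢ s n := by
    ext q
    simp only [Set.mem_preimage, Set.mem_univ_pi, Set.mem_prod]
    constructor
    · intro h
      refine ⟨fun i => ?_, by simpa using h n⟩
      by_cases hi : i = n
      · subst hi; simp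
      · simpa [hi] using h i
    · rintro ⟨h, hn⟩ i
      by_cases hi : i = n
      · subst hi; simpa using hn
      · simpa [hi] using h i
  rw [hpre, Measure.prod_prod, Measure.pi_pi, ← Finset.mul_prod_erase _ _ (Finset.mem_univ n),
    ← Finset.mul_prod_erase Finset.univ (fun i => Function.update ν n κ i (s i))
      (Finset.mem_univ n)]
  simp only [Function.update_self, measure_univ, one_mul]
  rw [mul_comm]
  congr 1
  refine Finset.prod_congr rfl fun i hi => ?_
  simp [Finset.ne_of_mem_erase hi]

theorem lintegral_pi_update (ν : ι → Measure E) [∀ i, IsProbabilityMeasure (ν i)] (n : ι)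
    (κ : Measure E) [IsProbabilityMeasure κ] {F : (ι → E) → ℝ≥0∞} (hF : Measurable F) :
    ∫⁻ y, F y ∂(Measure.pi (Function.update ν n κ))
      = ∫⁻ y, ∫⁻ u, F (Function.update y n u) ∂κ ∂(Measure.pi ν) := by
  have hm := measurable_update_prod (E := E) n
  rw [← map_update_prod_pi, lintegral_map hF hm, lintegral_prod _ (by fun_prop)]

theorem map_comp_pi {ι' : Type*} [Fintype ι'] (ν : ι → Measure E)
    [∀ i, IsProbabilityMeasure (ν i)] {e : ι' → ι} (he : Function.Injective e) :
    (Measure.pi ν).map (fun y i => y (e i)) = Measure.pi fun i => ν (e i) := by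
  refine (Measure.pi_eq fun s hs => ?_).symm
  rw [Measure.map_apply (measurable_pi_lambda _ fun i => measurable_pi_apply (e i))
    (MeasurableSet.univ_pi hs)]
  -- Coordinates outside the range of `e` receive an empty intersection, that is, no constraint.
  have hpre : (fun (y : ι → E) i => y (e i)) ⁻¹' Set.univ.pi s
      = Set.univ.pi (fun j => ⋂ i, ⋂ (_ : e i = j), s i) := by
    ext y
    simp only [Set.mem_preimage, Set.mem_univ_pi, Set.mem_iInter]
    exact ⟨fun h j i hi => hi ▸ h i, fun h i => h _ i rfl⟩
  rw [hpre, Measure.pi_pi, ← Finset.prod_subset (Finset.subset_univ (Finset.univ.image e)),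
    Finset.prod_image he.injOn]
  · refine Finset.prod_congr rfl fun i _ => ?_
    congr 1
    ext z
    simp only [Set.mem_iInter]
    exact ⟨fun h => h i rfl, fun h j hj => he hj ▸ h⟩
  · intro j _ hj
    have : (⋂ i, ⋂ (_ : e i = j), s i) = Set.univ := by
      simp only [Set.iInter_eq_univ]
      intro i hi
      exact absurd (Finset.mem_image.2 ⟨i, Finset.mem_univ _, hi⟩) hj
    rw [this, measure_univ]

end Product

/-! ### Uniform mixtures -/

section UniformMixture

variable {τ : Type*} [Fintype τ] {E : Type*} [MeasurableSpace E]

theorem uniformMixture_apply (κ : τ → Measure E) (A : Set E) :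
    uniformMixture κ A = (Fintype.card τ : ℝ≥0∞)⁻¹ * ∑ t, κ t A := by
  simp [uniformMixture]

theorem lintegral_uniformMixture (κ : τ → Measure E) (F : E → ℝ≥0∞) :
    ∫⁻ e, F e ∂(uniformMixture κ) = (Fintype.card τ : ℝ≥0∞)⁻¹ * ∑ t, ∫⁻ e, F e ∂(κ t) := by
  simp [uniformMixture]

instance isProbabilityMeasure_uniformMixture [Nonempty τ] (κ : τ → Measure E)
    [∀ t, IsProbabilityMeasure (κ t)] : IsProbabilityMeasure (uniformMixture κ) := by
  constructor
  simp only [uniformMixture_apply, measure_univ, Finset.sum_const, Finset.card_univ, nsmul_eq_mul,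
    mul_one]
  exact ENNReal.inv_mul_cancel (by simp) (by simp)

/-- Independent uniform indices: expanding a product of sums gives a sum over all choice functions.
-/
theorem uniformMixture_pi {ι : Type*} [Fintype ι] [DecidableEq ι] [Nonempty τ]
    (κ : ι → τ → Measure E)
    [∀ i t, IsProbabilityMeasure (κ i t)] :
    uniformMixture (fun t : ι → τ => Measure.pi fun i => κ i (t i))
      = Measure.pi fun i => uniformMixture (κ i) := by
  refine (Measure.pi_eq fun s hs => ?_).symm
  simp only [uniformMixture_apply, Measure.pi_pi, Finset.prod_mul_distrib, Finset.prod_univ_sum,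
    Fintype.piFinset_univ, Finset.prod_const, Fintype.card_fun, Finset.card_univ]
  rw [Nat.cast_pow, ENNReal.inv_pow]

end UniformMixture

/-! ### Gaussian noise on the line -/

instance isProbabilityMeasure_normal (μ : ℝ) (s : ℝ≥0) : IsProbabilityMeasure (normal μ s) := by
  unfold normal; infer_instance

theorem map_affine_normal (μ b a : ℝ) (s : ℝ≥0) :
    (normal μ s).map (fun y => b + a * y) = normal (b + a * μ) (s * ‖a‖₊) := by
  have : (fun y : ℝ => b + a * y) = (fun y => b + y) ∘ (fun y => a * y) := rfl
  rw [this, ← Measure.map_map (by fun_prop) (by fun_prop), normal, gaussianReal_map_const_mul,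
    gaussianReal_map_const_add, normal]
  congr 1
  · ring
  · ext
    push_cast
    simp [mul_pow, mul_comm]

/-- Rescaled noise contributes variance `s² (a - b)²`; independent noise supplies the missing `s²
(v² - (a - b)²)`. The same map serves every `μ`, so `μ = 0` and `μ = 1` exhibit the normals centred
at `a` and `b` as one post-processing of `N(0, s)` and `N(1, s)`. -/
theorem normal_eq_map_prod (a b μ : ℝ) (s v : ℝ≥0) (hab : |a - b| ≤ v) :
    normal (a + (b - a) * μ) (s * v)
      = ((normal μ s).prod (normal 0 s)).map
          (fun q => (a + (b - a) * q.1) + √(v ^ 2 - (a - b) ^ 2) * q.2) := by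
  have h0 : 0 ≤ (v : ℝ) ^ 2 - (a - b) ^ 2 := by
    have := sq_le_sq' (by linarith [neg_abs_le (a - b)]) ((le_abs_self _).trans hab)
    linarith
  have hconv : ((normal μ s).map (fun y => a + (b - a) * y)) ∗
      ((normal 0 s).map fun y => 0 + √(v ^ 2 - (a - b) ^ 2) * y)
      = normal (a + (b - a) * μ) (s * v) := by
    rw [map_affine_normal, map_affine_normal, normal, normal, gaussianReal_conv_gaussianReal,
      normal]
    congr 1
    · ring
    · ext
      push_cast
      simp only [mul_pow, Real.norm_eq_abs, sq_abs, Real.sq_sqrt h0]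
      ring
  rw [← hconv, Measure.conv, Measure.map_prod_map _ _ (by fun_prop) (by fun_prop),
    Measure.map_map (by fun_prop) (by fun_prop)]
  congr 1
  ext q
  simp

/-- Post-processing does not increase total variation: averaging `ψ` over the extra noise gives a
test on the line, still bounded by `B`. Degenerate scales need no separate treatment. -/
theorem lintegral_normal_le_add_tvd {a b : ℝ} (s : ℝ≥0) {v : ℝ≥0} (hab : |a - b| ≤ v)
    {ψ : ℝ → ℝ≥0∞} (hψ : Measurable ψ) {B : ℝ≥0∞} (hB : ∀ y, ψ y ≤ B) :
    ∫⁻ y, ψ y ∂(normal a (s * v)) ≤ ∫⁻ y, ψ y ∂(normal b (s * v))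
      + B * ENNReal.ofReal (tvd (normal 0 s) (normal 1 s)) := by
  have key : ∀ μ : ℝ, ∫⁻ y, ψ y ∂(normal (a + (b - a) * μ) (s * v))
      = ∫⁻ y, (∫⁻ z, ψ ((a + (b - a) * y) + √(v ^ 2 - (a - b) ^ 2) * z) ∂(normal 0 s))
        ∂(normal μ s) := by
    intro μ
    rw [normal_eq_map_prod _ _ _ _ _ hab, lintegral_map hψ (by fun_prop),
      lintegral_prod _ (by fun_prop)]
  have h0 := key 0
  have h1 := key 1
  rw [mul_zero, add_zero] at h0
  rw [show a + (b - a) * 1 = b by ring] at h1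
  rw [h0, h1, ofReal_tvd]
  refine (lintegral_le_of_hockeyStick (P := normal 0 s) (Q := normal 1 s) 1 ?_ (B := B)
    fun y => ?_).trans (by simp)
  · exact Measurable.lintegral_prod_right' (f := fun q : ℝ × ℝ =>
      ψ ((a + (b - a) * q.1) + √(v ^ 2 - (a - b) ^ 2) * q.2)) (by fun_prop)
  · calc _ ≤ ∫⁻ _, B ∂(normal 0 s) := lintegral_mono fun z => hB _
      _ = B := by simp

/-! ### Gaussian noise on vectors -/

section Vector

variable {E : Type*} [NormedAddCommGroup E] [InnerProductSpace ℝ E] [FiniteDimensional ℝ E]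
  [MeasurableSpace E] [BorelSpace E]

open scoped RealInnerProductSpace in
/-- A standard Gaussian vector splits off a one-dimensional Gaussian along any vector of norm at
most one. -/
theorem stdGaussian_eq_map_prod {w : E} (hw : ‖w‖ ≤ 1) :
    stdGaussian E = ((gaussianReal 0 1).prod (stdGaussian E)).map
      (fun q => q.1 • w + (q.2 - ((1 + √(1 - ‖w‖ ^ 2))⁻¹ * ⟪w, q.2⟫) • w)) := by
  set s := √(1 - ‖w‖ ^ 2) with hs
  have hs0 : 0 ≤ s := Real.sqrt_nonneg _
  have hs2 : ‖w‖ ^ 2 = 1 - s ^ 2 := by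
    rw [hs, Real.sq_sqrt]
    · ring
    · nlinarith [norm_nonneg w]
  -- With this constant, `I - c w wᵀ` is the positive semidefinite square root of `I - w wᵀ`: its
  -- factor along `w` is `1 - c ‖w‖² = s`. The two summands then have covariances `w wᵀ` and `I - w
  -- wᵀ`.
  set c := (1 + s)⁻¹ with hc
  have hconv : stdGaussian E = ((gaussianReal 0 1).map (fun y => y • w)) ∗
      ((stdGaussian E).map fun z => z - (c * ⟪w, z⟫) • w) := by
    apply Measure.ext_of_charFun
    ext t
    have hB : ∀ z : E, ⟪z - (c * ⟪w, z⟫) • w, t⟫ = ⟪z, t - (c * ⟪w, t⟫) • w⟫ := by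
      intro z
      rw [inner_sub_left, inner_sub_right, real_inner_smul_left, real_inner_smul_right,
        real_inner_comm w z]
      ring
    have e1 : charFun ((gaussianReal 0 1).map (fun y => y • w)) t
        = Complex.exp (-(⟪w, t⟫ : ℂ) ^ 2 / 2) := by
      rw [charFun_apply, integral_map (by fun_prop) (by fun_prop)]
      have := charFun_gaussianReal (μ := 0) (v := 1) ⟪w, t⟫
      rw [charFun_apply_real] at this
      simp only [real_inner_smul_left]
      convert this using 1
      · refine integral_congr_ae (Filter.Eventually.of_forall fun y => ?_)
        push_cast; ring_nf
      · simp [neg_div]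
    have e2 : charFun ((stdGaussian E).map fun z => z - (c * ⟪w, z⟫) • w) t
        = Complex.exp (-((‖t‖ : ℂ) ^ 2 - (⟪w, t⟫ : ℂ) ^ 2) / 2) := by
      rw [charFun_apply, integral_map (by fun_prop) (by fun_prop)]
      simp only [hB]
      rw [← charFun_apply, charFun_stdGaussian]
      have : ‖t - (c * ⟪w, t⟫) • w‖ ^ 2 = ‖t‖ ^ 2 - ⟪w, t⟫ ^ 2 := by
        rw [norm_sub_sq_real, norm_smul, mul_pow, real_inner_smul_right, hs2, Real.norm_eq_abs,
          sq_abs, real_inner_comm w t]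
        have : c * (1 + s) = 1 := inv_mul_cancel₀ (by positivity)
        linear_combination (⟪w, t⟫ ^ 2 * (c - c * s - 1)) * this
      rw [← Complex.ofReal_pow, this]
      push_cast
      rfl
    rw [charFun_conv, e1, e2, ← Complex.exp_add, charFun_stdGaussian]
    congr 1
    ring
  conv_lhs => rw [hconv]
  rw [Measure.conv, Measure.map_prod_map _ _ (by fun_prop) (by fun_prop),
    Measure.map_map (by fun_prop) (by fun_prop)]
  rfl

/-- The Gaussian mechanism on vectors at distance at most `2 C` is a post-processing of the
one-dimensional Gaussian mechanism with sensitivity two. -/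
theorem exists_gaussian_test {C : ℝ≥0} (hC : 0 < C) (σ : ℝ≥0) {u u' : E}
    (hu : ‖u - u'‖ ≤ 2 * C) {A : Set E} (hA : MeasurableSet A) :
    ∃ T : ℝ → ℝ≥0∞, Measurable T ∧ (∀ y, T y ≤ 1) ∧
      stdGaussian E {z | u' + ((σ * C : ℝ≥0) : ℝ) • z ∈ A} = ∫⁻ y, T y ∂(normal 0 σ) ∧
      stdGaussian E {z | u + ((σ * C : ℝ≥0) : ℝ) • z ∈ A} = ∫⁻ y, T y ∂(normal 2 σ) := by
  have hC' : (0 : ℝ) < C := hC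
  set w : E := (2 * (C : ℝ))⁻¹ • (u - u') with hw
  have hw1 : ‖w‖ ≤ 1 := by
    rw [hw, norm_smul, norm_inv, Real.norm_of_nonneg (by positivity),
      inv_mul_le_iff₀ (by positivity)]
    simpa using hu
  have huw : u = u' + (2 * (C : ℝ)) • w := by
    rw [hw, smul_smul, mul_inv_cancel₀ (by positivity), one_smul]; abel
  set c := (1 + √(1 - ‖w‖ ^ 2))⁻¹
  -- `T y` is the conditional probability of `A` once the scalar observation along `w` equals `y`;
  -- the remaining noise is integrated out and does not depend on the mean.
  let T : ℝ → ℝ≥0∞ := fun y => stdGaussian E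
    {z | u' + ((C : ℝ) * y) • w + ((σ * C : ℝ≥0) : ℝ) • (z - (c * inner ℝ w z) • w) ∈ A}
  have hT : Measurable T := by
    have hm : Measurable fun q : ℝ × E => u' + ((C : ℝ) * q.1) • w
        + ((σ * C : ℝ≥0) : ℝ) • (q.2 - (c * inner ℝ w q.2) • w) := by fun_prop
    exact measurable_measure_prodMk_left (hm hA)
  -- The mean `a = 0` yields the centre `u'`, and `a = 2` yields `u' + 2 C w = u`.
  have key : ∀ a : ℝ, stdGaussian E {z | u' + (a * C) • w + ((σ * C : ℝ≥0) : ℝ) • z ∈ A}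
      = ∫⁻ y, T y ∂(normal a σ) := by
    intro a
    have hN : normal a σ = (gaussianReal 0 1).map fun y => a + σ * y := by
      have := map_affine_normal 0 a σ 1
      rw [normal, one_pow] at this
      rw [this]
      simp
    rw [hN, lintegral_map hT (by fun_prop)]
    conv_lhs => rw [stdGaussian_eq_map_prod hw1]
    have hm : Measurable fun z : E => u' + (a * C) • w + ((σ * C : ℝ≥0) : ℝ) • z := by fun_prop
    have hmA : MeasurableSet {z : E | u' + (a * C) • w + ((σ * C : ℝ≥0) : ℝ) • z ∈ A} := hm hA
    rw [Measure.map_apply (by fun_prop) hmA, Measure.prod_apply]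
    · refine lintegral_congr fun y => ?_
      refine congrArg (stdGaussian E) ?_
      ext z
      simp only [Set.mem_preimage, Set.mem_ofPred_eq]
      refine iff_of_eq (congrArg (· ∈ A) ?_)
      push_cast
      module
    · refine MeasurableSet.preimage hmA (by fun_prop)
  refine ⟨T, hT, fun y => prob_le_one, ?_, ?_⟩
  · simpa using key 0
  · rw [← key 2, huw]

end Vector

/-- The centres differ in coordinate `k` alone; conditioning on the other coordinates reduces to the
scalar estimate. -/
theorem lintegral_pi_normal_shift_le {ι : Type*} [Fintype ι] [DecidableEq ι] {y y' : ι → ℝ}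
    {k : ι} {s v : ℝ≥0} (hy : ∀ i, i ≠ k → y i = y' i) (hk : |y k - y' k| ≤ v)
    {ψ : (ι → ℝ) → ℝ≥0∞} (hψ : Measurable ψ) {B : ℝ≥0∞} (hB : ∀ z, ψ z ≤ B) :
    ∫⁻ z, ψ (y + z) ∂(Measure.pi fun _ => normal 0 (s * v))
      ≤ ∫⁻ z, ψ (y' + z) ∂(Measure.pi fun _ => normal 0 (s * v))
        + B * ENNReal.ofReal (tvd (normal 0 s) (normal 1 s)) := by
  have key : ∀ x : ι → ℝ, (∀ i, i ≠ k → x i = y' i) →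
      ∫⁻ z, ψ (x + z) ∂(Measure.pi fun _ => normal 0 (s * v))
      = ∫⁻ z, ∫⁻ u, ψ (Function.update (y' + z) k u) ∂(normal (x k) (s * v))
          ∂(Measure.pi fun _ => normal 0 (s * v)) := by
    intro x hx
    have h1 := lintegral_pi_update (fun _ : ι => normal 0 (s * v)) k (normal 0 (s * v))
      (F := fun z => ψ (x + z)) (by fun_prop)
    rw [Function.update_eq_self] at h1
    rw [h1]
    refine lintegral_congr fun z => ?_
    have hN : normal (x k) (s * v) = (normal 0 (s * v)).map fun u => x k + 1 * u := by
      rw [map_affine_normal]; simp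
    have hm : Measurable fun u => ψ (Function.update (y' + z) k u) :=
      hψ.comp (measurable_update _)
    rw [hN, lintegral_map hm (by fun_prop)]
    refine lintegral_congr fun u => congrArg ψ ?_
    ext i
    by_cases hi : i = k
    · subst hi; simp
    · simp [hi, hx i hi]
  rw [key y hy, key y' fun _ _ => rfl]
  have hm : Measurable fun z : ι → ℝ =>
      ∫⁻ u, ψ (Function.update (y' + z) k u) ∂(normal (y' k) (s * v)) := by
    refine Measurable.lintegral_prod_right'
      (f := fun q : (ι → ℝ) × ℝ => ψ (Function.update (y' + q.1) k q.2)) ?_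
    exact hψ.comp ((measurable_update_prod k).comp
      (f := fun q : (ι → ℝ) × ℝ => (y' + q.1, q.2)) (by fun_prop))
  calc _ ≤ ∫⁻ z, (∫⁻ u, ψ (Function.update (y' + z) k u) ∂(normal (y' k) (s * v))
          + B * ENNReal.ofReal (tvd (normal 0 s) (normal 1 s)))
          ∂(Measure.pi fun _ => normal 0 (s * v)) :=
        lintegral_mono fun z => lintegral_normal_le_add_tvd s hk
          (hψ.comp (measurable_update _)) fun u => hB _
    _ = _ := by rw [lintegral_add_left hm]; simp

/-! ### Total variation between window laws of neighbouring series -/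

namespace Params

variable (c : Params)

/-- The context and forecast windows at start position `t`. -/
def windows (a : Fin c.L → ℝ) (t : ℕ) : c.AugNoise :=
  (contextWindow c.L_C a t, forecastWindow c.L_C c.L_F a t)

/-- Law of the augmented windows of one uniformly drawn subsequence of the series `a`. -/
noncomputable def windowLaw (a : Fin c.L → ℝ) : Measure c.AugNoise :=
  uniformMixture fun t : Fin c.T => c.augLaw.map fun z => c.windows a t + z

instance isProbabilityMeasure_augLaw : IsProbabilityMeasure c.augLaw := by
  unfold augLaw; infer_instance

instance isProbabilityMeasure_map_add_augLaw (y : c.AugNoise) :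
    IsProbabilityMeasure (c.augLaw.map fun z => y + z) :=
  Measure.isProbabilityMeasure_map (by fun_prop)

instance isProbabilityMeasure_windowLaw (a : Fin c.L → ℝ) :
    IsProbabilityMeasure (c.windowLaw a) := by
  unfold windowLaw; infer_instance

theorem lintegral_augLaw {ψ : c.AugNoise → ℝ≥0∞} (hψ : Measurable ψ) (y : c.AugNoise) :
    ∫⁻ e, ψ e ∂(c.augLaw.map fun z => y + z)
      = ∫⁻ z, ∫⁻ z', ψ (y.1 + z, y.2 + z') ∂(Measure.pi fun _ => normal 0 (c.σ_F * c.v))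
          ∂(Measure.pi fun _ => normal 0 (c.σ_C * c.v)) := by
  rw [lintegral_map hψ (by fun_prop), augLaw, lintegral_prod _ (by fun_prop)]
  rfl

theorem lintegral_augLaw_context_le {y y' : c.AugNoise} {k : Fin c.L_C} (h2 : y.2 = y'.2)
    (h1 : ∀ i, i ≠ k → y.1 i = y'.1 i) (hk : |y.1 k - y'.1 k| ≤ c.v)
    {ψ : c.AugNoise → ℝ≥0∞} (hψ : Measurable ψ) {B : ℝ≥0∞} (hB : ∀ z, ψ z ≤ B) :
    ∫⁻ e, ψ e ∂(c.augLaw.map fun z => y + z) ≤ ∫⁻ e, ψ e ∂(c.augLaw.map fun z => y' + z)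
      + B * ENNReal.ofReal (tvd (normal 0 c.σ_C) (normal 1 c.σ_C)) := by
  rw [lintegral_augLaw c hψ, lintegral_augLaw c hψ, h2]
  refine lintegral_pi_normal_shift_le (ψ := fun z => ∫⁻ z', ψ (z, y'.2 + z')
    ∂(Measure.pi fun _ => normal 0 (c.σ_F * c.v))) h1 hk ?_ fun z => ?_
  · exact Measurable.lintegral_prod_right' (f := fun q : c.AugNoise => ψ (q.1, y'.2 + q.2))
      (by fun_prop)
  · exact (lintegral_mono fun z' => hB _).trans (by simp)

theorem lintegral_augLaw_forecast_le {y y' : c.AugNoise} {k : Fin c.L_F} (h1 : y.1 = y'.1)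
    (h2 : ∀ i, i ≠ k → y.2 i = y'.2 i) (hk : |y.2 k - y'.2 k| ≤ c.v)
    {ψ : c.AugNoise → ℝ≥0∞} (hψ : Measurable ψ) {B : ℝ≥0∞} (hB : ∀ z, ψ z ≤ B) :
    ∫⁻ e, ψ e ∂(c.augLaw.map fun z => y + z) ≤ ∫⁻ e, ψ e ∂(c.augLaw.map fun z => y' + z)
      + B * ENNReal.ofReal (tvd (normal 0 c.σ_F) (normal 1 c.σ_F)) := by
  rw [lintegral_augLaw c hψ, lintegral_augLaw c hψ, h1]
  calc _ ≤ ∫⁻ z, (∫⁻ z', ψ (y'.1 + z, y'.2 + z') ∂(Measure.pi fun _ => normal 0 (c.σ_F * c.v))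
          + B * ENNReal.ofReal (tvd (normal 0 c.σ_F) (normal 1 c.σ_F)))
          ∂(Measure.pi fun _ => normal 0 (c.σ_C * c.v)) :=
        lintegral_mono fun z => lintegral_pi_normal_shift_le (ψ := fun z' => ψ (y'.1 + z, z'))
          h2 hk (by fun_prop) fun u => hB _
    _ = _ := by
      rw [lintegral_add_right _ measurable_const]; simp

end Params

theorem prependZeros_eq {L : ℕ} {L_C : ℕ} {a a' : Fin L → ℝ} {i : Fin L}
    (h : ∀ j, j ≠ i → a j = a' j) {k : ℕ} (hk : k ≠ L_C + i) :
    prependZeros L_C a k = prependZeros L_C a' k := by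
  unfold prependZeros
  split_ifs with hc
  · refine h _ fun he => hk ?_
    have := congrArg Fin.val he
    simp only at this
    omega
  · rfl

theorem abs_prependZeros_sub_le {L : ℕ} {L_C : ℕ} {a a' : Fin L → ℝ} {v : ℝ≥0}
    (h : ∀ j, |a j - a' j| ≤ v) (k : ℕ) :
    |prependZeros L_C a k - prependZeros L_C a' k| ≤ v := by
  unfold prependZeros
  split_ifs with hc
  · exact h _
  · simp

namespace Params

variable (c : Params)

/-- The changed value sits at padded position `L_C + i`. It falls into the context window iff `i < t
≤ i + L_C`, and into the forecast window iff `i - L_F < t ≤ i`. The second range is taken in `ℤ`,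
since truncated subtraction would lose `t = 0` when `i < L_F`. -/
theorem lintegral_windows_le {a a' : Fin c.L → ℝ} {i : Fin c.L} (h : ∀ j, j ≠ i → a j = a' j)
    (hv : ∀ j, |a j - a' j| ≤ c.v) (t : ℕ)
    {ψ : c.AugNoise → ℝ≥0∞} (hψ : Measurable ψ) {B : ℝ≥0∞} (hB : ∀ z, ψ z ≤ B) :
    ∫⁻ e, ψ e ∂(c.augLaw.map fun z => c.windows a t + z)
      ≤ ∫⁻ e, ψ e ∂(c.augLaw.map fun z => c.windows a' t + z)
      + B * ((if t ∈ Finset.Ioc (i : ℕ) (i + c.L_C) then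
          ENNReal.ofReal (tvd (normal 0 c.σ_C) (normal 1 c.σ_C)) else 0)
        + (if (t : ℤ) ∈ Finset.Ioc ((i : ℕ) - c.L_F : ℤ) i then
          ENNReal.ofReal (tvd (normal 0 c.σ_F) (normal 1 c.σ_F)) else 0)) := by
  by_cases h1 : t ∈ Finset.Ioc (i : ℕ) (i + c.L_C)
  · rw [Finset.mem_Ioc] at h1
    refine (c.lintegral_augLaw_context_le (k := ⟨c.L_C + i - t, by omega⟩) (y' := c.windows a' t)
      ?_ ?_ ?_ hψ hB).trans ?_
    · ext k
      exact prependZeros_eq h (by omega)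
    · intro k hk
      refine prependZeros_eq h fun hc => hk ?_
      ext
      simp only
      omega
    · exact abs_prependZeros_sub_le hv _
    · rw [if_pos (Finset.mem_Ioc.2 h1)]
      gcongr
      exact le_self_add
  by_cases h2 : (t : ℤ) ∈ Finset.Ioc ((i : ℕ) - c.L_F : ℤ) i
  · rw [Finset.mem_Ioc] at h2
    refine (c.lintegral_augLaw_forecast_le (k := ⟨i - t, by omega⟩) (y' := c.windows a' t)
      ?_ ?_ ?_ hψ hB).trans ?_
    · ext k
      exact prependZeros_eq h (by omega)
    · intro k hk
      refine prependZeros_eq h fun hc => hk ?_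
      ext
      simp only
      omega
    · exact abs_prependZeros_sub_le hv _
    · rw [if_pos (Finset.mem_Ioc.2 h2)]
      gcongr
      exact le_add_self
  · have : c.windows a t = c.windows a' t := by
      rw [Finset.mem_Ioc] at h1 h2
      refine Prod.ext ?_ ?_
      · ext k
        exact prependZeros_eq h (by omega)
      · ext k
        exact prependZeros_eq h (by omega)
    rw [this]
    exact le_self_add

/-- Bound on the total variation distance between the window laws of neighbouring series. -/
noncomputable def windowTV : ℝ≥0∞ := (c.T : ℝ≥0∞)⁻¹ *
  (c.L_C * ENNReal.ofReal (tvd (normal 0 c.σ_C) (normal 1 c.σ_C))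
    + c.L_F * ENNReal.ofReal (tvd (normal 0 c.σ_F) (normal 1 c.σ_F)))

theorem lintegral_windowLaw_le {a a' : Fin c.L → ℝ} {i : Fin c.L} (h : ∀ j, j ≠ i → a j = a' j)
    (hv : ∀ j, |a j - a' j| ≤ c.v)
    {ψ : c.AugNoise → ℝ≥0∞} (hψ : Measurable ψ) {B : ℝ≥0∞} (hB : ∀ z, ψ z ≤ B) :
    ∫⁻ e, ψ e ∂(c.windowLaw a) ≤ ∫⁻ e, ψ e ∂(c.windowLaw a') + B * c.windowTV := by
  -- Only an upper bound on the counts: near the ends of the series some of these start positions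
  -- are not admissible.
  have hcount1 : (Finset.univ.filter fun t : Fin c.T =>
      (t : ℕ) ∈ Finset.Ioc (i : ℕ) (i + c.L_C)).card ≤ c.L_C := by
    calc _ = ((Finset.univ.filter fun t : Fin c.T =>
          (t : ℕ) ∈ Finset.Ioc (i : ℕ) (i + c.L_C)).image Fin.val).card :=
          (Finset.card_image_of_injective _ Fin.val_injective).symm
      _ ≤ (Finset.Ioc (i : ℕ) (i + c.L_C)).card := Finset.card_le_card fun t ht => by
          obtain ⟨u, hu, rfl⟩ := Finset.mem_image.1 ht
          exact (Finset.mem_filter.1 hu).2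
      _ = c.L_C := by simp
  have hcount2 : (Finset.univ.filter fun t : Fin c.T =>
      ((t : ℕ) : ℤ) ∈ Finset.Ioc ((i : ℕ) - c.L_F : ℤ) i).card ≤ c.L_F := by
    calc _ = ((Finset.univ.filter fun t : Fin c.T =>
          ((t : ℕ) : ℤ) ∈ Finset.Ioc ((i : ℕ) - c.L_F : ℤ) i).image
            fun t : Fin c.T => ((t : ℕ) : ℤ)).card :=
          (Finset.card_image_of_injective _
            (Nat.cast_injective.comp Fin.val_injective)).symm
      _ ≤ (Finset.Ioc ((i : ℕ) - c.L_F : ℤ) i).card := Finset.card_le_card fun t ht => by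
          obtain ⟨u, hu, rfl⟩ := Finset.mem_image.1 ht
          exact (Finset.mem_filter.1 hu).2
      _ = c.L_F := by simp
  rw [windowLaw, windowLaw, lintegral_uniformMixture, lintegral_uniformMixture]
  have hle := fun t : Fin c.T => c.lintegral_windows_le h hv (t : ℕ) hψ hB
  refine (mul_le_mul_right (Finset.sum_le_sum fun t _ => hle t) _).trans ?_
  rw [Finset.sum_add_distrib, mul_add, ← Finset.mul_sum, Finset.sum_add_distrib, windowTV,
    ← Finset.sum_filter, ← Finset.sum_filter, Finset.sum_const, Finset.sum_const,
    nsmul_eq_mul, nsmul_eq_mul, Fintype.card_fin, mul_left_comm (_⁻¹) B]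
  gcongr

end Params

/-! ### Clipping and the law of one training step -/

theorem measurable_clip {D : ℕ} (C : ℝ≥0) :
    Measurable (clip C : EuclideanSpace ℝ (Fin D) → EuclideanSpace ℝ (Fin D)) := by
  unfold clip
  fun_prop

theorem norm_clip_le {D : ℕ} {C : ℝ≥0} (hC : 0 < C) (g : EuclideanSpace ℝ (Fin D)) :
    ‖clip C g‖ ≤ C := by
  have hC' : (0 : ℝ) < C := hC
  rw [clip, norm_smul, Real.norm_of_nonneg (by positivity), inv_mul_le_iff₀ (by positivity)]
  calc ‖g‖ = ‖g‖ / C * C := by field_simp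
    _ ≤ _ := by gcongr; exact le_max_right _ _

namespace Params

variable (c : Params)

/-- Probability that the updated parameters land in `A` when the clipped gradients sum to `u`. -/
noncomputable def updateProb (θ : c.Theta) (A : Set c.Theta) (u : c.Theta) : ℝ≥0∞ :=
  stdGaussian c.Theta {z | θ - c.η • ((c.Lam : ℝ)⁻¹ • (u + ((c.σ * c.C : ℝ≥0) : ℝ) • z)) ∈ A}

theorem measurable_updateProb (θ : c.Theta) {A : Set c.Theta} (hA : MeasurableSet A) :
    Measurable (c.updateProb θ A) := by
  have hm : Measurable fun q : c.Theta × c.Theta =>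
      θ - c.η • ((c.Lam : ℝ)⁻¹ • (q.1 + ((c.σ * c.C : ℝ≥0) : ℝ) • q.2)) := by fun_prop
  exact measurable_measure_prodMk_left (hm hA)

theorem measurable_stepOutput {g : (Fin c.L_C → ℝ) × (Fin c.L_F → ℝ) → c.Theta}
    (hg : Measurable g) (θ : c.Theta) (x : Dataset c.N c.L) (π : Equiv.Perm (Fin c.N))
    (t : c.Slot → Fin c.lam → Fin c.T) : Measurable (c.stepOutput g θ x π t) := by
  have hclip := measurable_clip (D := c.D) c.C
  unfold stepOutput
  fun_prop

theorem isProbabilityMeasure_stepLaw {g : (Fin c.L_C → ℝ) × (Fin c.L_F → ℝ) → c.Theta}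
    (hg : Measurable g) (θ : c.Theta) (x : Dataset c.N c.L) :
    IsProbabilityMeasure (c.stepLaw g θ x) := by
  have : IsProbabilityMeasure c.noiseLaw := by unfold noiseLaw; infer_instance
  have : ∀ π t, IsProbabilityMeasure (c.noiseLaw.map (c.stepOutput g θ x π t)) := fun π t =>
    Measure.isProbabilityMeasure_map (c.measurable_stepOutput hg θ x π t).aemeasurable
  unfold stepLaw
  infer_instance

theorem map_stepOutput_apply {g : (Fin c.L_C → ℝ) × (Fin c.L_F → ℝ) → c.Theta}
    (hg : Measurable g) (θ : c.Theta) (x : Dataset c.N c.L) (π : Equiv.Perm (Fin c.N))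
    (t : c.Slot → Fin c.lam → Fin c.T) {A : Set c.Theta} (hA : MeasurableSet A) :
    c.noiseLaw.map (c.stepOutput g θ x π t) A
      = ∫⁻ y, c.updateProb θ A (∑ n : c.Slot, ∑ j, clip c.C (g (y n j)))
        ∂(Measure.pi fun n : c.Slot => Measure.pi fun j =>
          c.augLaw.map fun z => c.windows (x (π n)) (t n j) + z) := by
  have hclip := measurable_clip (D := c.D) c.C
  have hm1 : Measurable fun y : c.Slot → Fin c.lam → c.AugNoise =>
      ∑ n : c.Slot, ∑ j, clip c.C (g (y n j)) := by fun_prop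
  have hshift : (Measure.pi fun _ : c.Slot => Measure.pi fun _ : Fin c.lam => c.augLaw).map
        (fun y (n : c.Slot) j => c.windows (x (π n)) (t n j) + y n j)
      = Measure.pi fun n : c.Slot => Measure.pi fun j =>
          c.augLaw.map fun z => c.windows (x (π n)) (t n j) + z := by
    have hin : ∀ n : c.Slot, (Measure.pi fun _ : Fin c.lam => c.augLaw).map
        (fun y j => c.windows (x (π n)) (t n j) + y j)
        = Measure.pi fun j => c.augLaw.map fun z => c.windows (x (π n)) (t n j) + z := fun n =>
      Measure.pi_map_pi (μ := fun _ : Fin c.lam => c.augLaw)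
        (f := fun j z => c.windows (x (π n)) (t n j) + z) fun j => by fun_prop
    simp only [← hin]
    refine Measure.pi_map_pi (hμ := fun n => ?_)
      (f := fun (n : c.Slot) (y : Fin c.lam → c.AugNoise) j => c.windows (x (π n)) (t n j) + y j)
      fun n => ?_
    · simp only [hin]; infer_instance
    · exact (measurable_pi_lambda _ fun j =>
        measurable_const.add (measurable_pi_apply j)).aemeasurable
  have hm := c.measurable_stepOutput hg θ x π t
  have hm2 : Measurable fun y : c.Slot → Fin c.lam → c.AugNoise =>
      c.updateProb θ A (∑ n : c.Slot, ∑ j, clip c.C (g (y n j))) :=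
    (c.measurable_updateProb θ hA).comp hm1
  have hadd : Measurable fun (y : c.Slot → Fin c.lam → c.AugNoise) (n : c.Slot) j =>
      c.windows (x (π n)) (t n j) + y n j :=
    measurable_pi_lambda _ fun n => measurable_pi_lambda _ fun j =>
      measurable_const.add ((measurable_pi_apply j).comp (measurable_pi_apply n))
  rw [← hshift, lintegral_map hm2 hadd,
    Measure.map_apply hm hA, noiseLaw, Measure.prod_apply (hm hA)]
  rfl

/-- Windows may be drawn independently for all `N` series, selected or not, before the batch is read
off. This makes the law of `y` independent of `π`, so different permutations can be compared on the
same windows. -/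
theorem stepLaw_apply (hlam : c.lam = 1) {g : (Fin c.L_C → ℝ) × (Fin c.L_F → ℝ) → c.Theta}
    (hg : Measurable g) (θ : c.Theta) (x : Dataset c.N c.L) {A : Set c.Theta}
    (hA : MeasurableSet A) :
    c.stepLaw g θ x A = (Fintype.card (Equiv.Perm (Fin c.N)) : ℝ≥0∞)⁻¹ *
      ∑ π : Equiv.Perm (Fin c.N),
        ∫⁻ y, c.updateProb θ A (∑ n : c.Slot, clip c.C (g (y (π n))))
          ∂(Measure.pi fun m => c.windowLaw (x m)) := by
  have hclip := measurable_clip (D := c.D) c.C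
  have hU := c.measurable_updateProb θ hA
  let _ : Unique (Fin c.lam) := by rw [hlam]; infer_instance
  rw [stepLaw, uniformMixture_apply]
  congr 1
  refine Finset.sum_congr rfl fun π _ => ?_
  rw [uniformMixture_apply]
  simp only [c.map_stepOutput_apply hg θ x π _ hA]
  rw [← lintegral_uniformMixture]
  rw [uniformMixture_pi (fun (n : c.Slot) (t : Fin c.lam → Fin c.T) =>
    Measure.pi fun j => c.augLaw.map fun z => c.windows (x (π n)) (t j) + z)]
  have hw : ∀ n : c.Slot, uniformMixture (fun t : Fin c.lam → Fin c.T =>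
      Measure.pi fun j => c.augLaw.map fun z => c.windows (x (π n)) (t j) + z)
      = Measure.pi fun _ => c.windowLaw (x (π n)) := fun n =>
    uniformMixture_pi fun (_ : Fin c.lam) (t : Fin c.T) =>
      c.augLaw.map fun z => c.windows (x (π n)) t + z
  simp only [hw, Fintype.sum_unique]
  have h1 : (Measure.pi fun n : c.Slot => Measure.pi fun _ : Fin c.lam =>
        c.windowLaw (x (π n))).map (fun y n => y n default)
      = (Measure.pi fun m => c.windowLaw (x m)).map fun y (n : c.Slot) => y (π n) := by
    have hev : ∀ n : c.Slot, (Measure.pi fun _ : Fin c.lam => c.windowLaw (x (π n))).map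
        (fun y => y default) = c.windowLaw (x (π n)) := fun n =>
      (measurePreserving_eval (fun _ : Fin c.lam => c.windowLaw (x (π n))) default).map_eq
    rw [map_comp_pi (e := fun n : c.Slot => π n) (fun m => c.windowLaw (x m))
      (π.injective.comp Subtype.val_injective)]
    refine (Measure.pi_map_pi (hμ := fun n => ?_)
      (f := fun (_ : c.Slot) (y : Fin c.lam → c.AugNoise) => y default) fun n => ?_).trans ?_
    · simp only [hev]; infer_instance
    · exact (measurable_pi_apply _).aemeasurable
    · simp only [hev]
  have hm : Measurable fun y : c.Slot → c.AugNoise =>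
      c.updateProb θ A (∑ n : c.Slot, clip c.C (g (y n))) := by fun_prop
  calc _ = ∫⁻ y, c.updateProb θ A (∑ n : c.Slot, clip c.C (g (y n)))
        ∂((Measure.pi fun n : c.Slot => Measure.pi fun _ : Fin c.lam =>
        c.windowLaw (x (π n))).map (fun y n => y n default)) := by
        rw [lintegral_map hm (by fun_prop)]
    _ = _ := by rw [h1, lintegral_map hm (by fun_prop)]

end Params

/-! ### From pairwise test inequalities to averages -/

theorem mul_iSup_le_mul_iInf_add {I : Type*} [Nonempty I] {h : I → ℝ} {a b ε : ℝ} (ha : 0 ≤ a)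
    (hb : 0 ≤ b) (hab : ∀ i j, a * h i ≤ b * h j + ε) : a * ⨆ i, h i ≤ b * (⨅ i, h i) + ε := by
  rw [Real.mul_iSup_of_nonneg ha, Real.mul_iInf_of_nonneg hb]
  refine ciSup_le fun i => ?_
  rw [← sub_le_iff_le_add]
  exact le_ciInf fun j => sub_le_iff_le_add.2 (hab i j)

theorem lintegral_mixtureOfGaussians {p : ℝ} (σ : ℝ≥0) (T : ℝ → ℝ≥0∞) :
    ∫⁻ y, T y ∂(mixtureOfGaussians ![0, 2] ![1 - p, p] σ)
      = ENNReal.ofReal (1 - p) * ∫⁻ y, T y ∂(normal 0 σ)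
        + ENNReal.ofReal p * ∫⁻ y, T y ∂(normal 2 σ) := by
  simp [mixtureOfGaussians, Fin.sum_univ_two]

/-- Hockey-stick divergence at order `α` between the Gaussian mixture with weight `p` on mean two
and the centred Gaussian, with the mixture first exactly when `1 ≤ α`. -/
noncomputable def profileBound (p : ℝ) (σ α : ℝ≥0) : ℝ≥0∞ :=
  if 1 ≤ α then hockeyStick α (mixtureOfGaussians ![0, 2] ![1 - p, p] σ) (normal 0 σ)
  else hockeyStick α (normal 0 σ) (mixtureOfGaussians ![0, 2] ![1 - p, p] σ)

instance isFiniteMeasure_mixtureOfGaussians {K : ℕ} (μ p : Fin K → ℝ) (s : ℝ≥0) :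
    IsFiniteMeasure (mixtureOfGaussians μ p s) := by
  constructor
  simp [mixtureOfGaussians, ENNReal.sum_lt_top]

/-- If `h` satisfies the inequalities of the one-dimensional Gaussian mechanism between any two of
its values, then so do averages of `h` that are close to each other relative to its oscillation. -/
theorem le_mul_add_of_oscillation {I : Type*} [Nonempty I] {h : I → ℝ≥0∞} (h1 : ∀ i, h i ≤ 1)
    {p : ℝ} (hp : p ∈ Set.Icc (0 : ℝ) 1) {α : ℝ≥0} {ε Φ Φ' : ℝ≥0∞}
    (hge : 1 ≤ α → ∀ i j, ENNReal.ofReal (1 - p) * h j + ENNReal.ofReal p * h i ≤ α * h j + ε)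
    (hlt : α < 1 → ∀ i j,
      h i ≤ α * (ENNReal.ofReal (1 - p) * h i + ENNReal.ofReal p * h j) + ε)
    (hΦ : Φ ≤ ⨆ i, h i) (hΦ' : ⨅ i, h i ≤ Φ') (hΦ'1 : Φ' ≤ 1)
    (hosc : Φ ≤ Φ' + ENNReal.ofReal p * ((⨆ i, h i) - ⨅ i, h i)) : Φ ≤ α * Φ' + ε := by
  rcases eq_or_ne ε ⊤ with rfl | hε
  · simp
  have hfin : ∀ i, h i ≠ ⊤ := fun i => ne_top_of_le_ne_top ENNReal.one_ne_top (h1 i)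
  have hS1 : ⨆ i, h i ≤ 1 := iSup_le h1
  have hS : ⨆ i, h i ≠ ⊤ := ne_top_of_le_ne_top ENNReal.one_ne_top hS1
  have hsS : ⨅ i, h i ≤ ⨆ i, h i := iInf_le_iSup
  have hs : ⨅ i, h i ≠ ⊤ := ne_top_of_le_ne_top hS hsS
  have hΦf : Φ ≠ ⊤ := ne_top_of_le_ne_top hS hΦ
  have hΦ'f : Φ' ≠ ⊤ := ne_top_of_le_ne_top ENNReal.one_ne_top hΦ'1
  have hp1 : 0 ≤ 1 - p := sub_nonneg.2 hp.2
  have hα : (0 : ℝ) ≤ α := α.2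
  have eS := ENNReal.toReal_iSup hfin
  have es := ENNReal.toReal_iInf hfin
  have r1 := ENNReal.toReal_mono hS hΦ
  have r2 := ENNReal.toReal_mono hΦ'f hΦ'
  have r3 := ENNReal.toReal_mono (by finiteness) hosc
  rw [ENNReal.toReal_add hΦ'f (by finiteness), ENNReal.toReal_mul, ENNReal.toReal_ofReal hp.1,
    ENNReal.toReal_sub_of_le hsS hS] at r3
  rw [← ENNReal.toReal_le_toReal hΦf (by finiteness), ENNReal.toReal_add (by finiteness) hε,
    ENNReal.toReal_mul, ENNReal.coe_toReal]
  rw [eS, es] at r3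
  rw [eS] at r1
  rw [es] at r2
  by_cases hα1 : 1 ≤ α
  · have hα1' : (1 : ℝ) ≤ α := hα1
    -- With `S`, `s` the extrema of `h`, this reads `p S ≤ (α - 1 + p) s + ε`. Then `Φ ≤ α Φ' - (α -
    -- 1) Φ' + p (S - s)`, where `Φ' ≥ s`, gives the claim.
    have := mul_iSup_le_mul_iInf_add (h := fun i => (h i).toReal) (ε := ε.toReal) hp.1
      (b := α - 1 + p) (by linarith [hp.1]) fun i j => by
        have := ENNReal.toReal_mono (by have := hfin j; finiteness) (hge hα1 i j)
        rw [ENNReal.toReal_add (by have := hfin j; finiteness) (by have := hfin i; finiteness),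
          ENNReal.toReal_add (by have := hfin j; finiteness) hε,
          ENNReal.toReal_mul, ENNReal.toReal_mul, ENNReal.toReal_mul, ENNReal.coe_toReal,
          ENNReal.toReal_ofReal hp1, ENNReal.toReal_ofReal hp.1] at this
        linarith
    have := mul_nonneg (sub_nonneg.2 hα1') (sub_nonneg.2 r2)
    linarith
  · have hα1' : (α : ℝ) < 1 := not_le.1 hα1
    -- Here `(1 - α (1 - p)) S ≤ α p s + ε`. Split `Φ = (1 - α) Φ + α Φ`, bounding the first term by
    -- `S` and the second by the oscillation estimate.
    have := mul_iSup_le_mul_iInf_add (h := fun i => (h i).toReal) (ε := ε.toReal)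
      (a := 1 - α * (1 - p)) (b := α * p) (by nlinarith [hp.1]) (mul_nonneg hα hp.1)
      fun i j => by
        have hi := hfin i
        have hj := hfin j
        have := ENNReal.toReal_mono (by finiteness) (hlt (not_le.1 hα1) i j)
        rw [ENNReal.toReal_add (by finiteness) hε, ENNReal.toReal_mul,
          ENNReal.toReal_add (by finiteness) (by finiteness),
          ENNReal.toReal_mul, ENNReal.toReal_mul, ENNReal.coe_toReal,
          ENNReal.toReal_ofReal hp1, ENNReal.toReal_ofReal hp.1] at this
        linarith
    have h3 := mul_le_mul_of_nonneg_left r3 hα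
    have h4 := mul_le_mul_of_nonneg_left r1 (sub_nonneg.2 hα1'.le)
    linarith

/-- A sum over all permutations, organised by the preimage of `n`. -/
theorem sum_perm_eq_sum_swap {ι M : Type*} [Fintype ι] [DecidableEq ι] [AddCommMonoid M]
    (i₀ n : ι) (F : Equiv.Perm ι → M) :
    ∑ π, F π = ∑ π ∈ Finset.univ.filter (fun π : Equiv.Perm ι => π i₀ = n),
      ∑ k, F (π * Equiv.swap i₀ k) := by
  rw [Finset.sum_comm]
  have h1 : ∀ π : Equiv.Perm ι, F π = ∑ k, if π k = n then F π else 0 := by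
    intro π
    rw [Finset.sum_eq_single (π.symm n)]
    · simp
    · intro k _ hk
      rw [if_neg]
      rintro rfl
      simp at hk
    · simp
  calc ∑ π, F π = ∑ π : Equiv.Perm ι, ∑ k, if π k = n then F π else 0 :=
        Finset.sum_congr rfl fun π _ => h1 π
    _ = ∑ k, ∑ π : Equiv.Perm ι, if π k = n then F π else 0 := Finset.sum_comm
    _ = _ := Finset.sum_congr rfl fun k _ => by
      rw [Finset.sum_filter, ← Equiv.sum_comp (Equiv.mulRight (Equiv.swap i₀ k))]
      simp

/-! ### Exchanging the changed series in and out of the batch -/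

namespace Params

variable (c : Params)

theorem updateProb_le_one (θ : c.Theta) (A : Set c.Theta) (u : c.Theta) :
    c.updateProb θ A u ≤ 1 := prob_le_one

theorem exists_updateProb_test (hC : 0 < c.C) (θ : c.Theta) {A : Set c.Theta}
    (hA : MeasurableSet A) {u u' : c.Theta} (hu : ‖u - u'‖ ≤ 2 * c.C) :
    ∃ T : ℝ → ℝ≥0∞, Measurable T ∧ (∀ y, T y ≤ 1) ∧
      c.updateProb θ A u' = ∫⁻ y, T y ∂(normal 0 c.σ) ∧
      c.updateProb θ A u = ∫⁻ y, T y ∂(normal 2 c.σ) := by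
  have hm : Measurable fun y : c.Theta => θ - c.η • ((c.Lam : ℝ)⁻¹ • y) := by fun_prop
  exact exists_gaussian_test hC c.σ hu (hm hA)

theorem updateProb_le_of_one_le (hC : 0 < c.C) (θ : c.Theta) {A : Set c.Theta}
    (hA : MeasurableSet A) {u u' : c.Theta} (hu : ‖u - u'‖ ≤ 2 * c.C) (p : ℝ) {α : ℝ≥0}
    (hα : 1 ≤ α) :
    ENNReal.ofReal (1 - p) * c.updateProb θ A u' + ENNReal.ofReal p * c.updateProb θ A u
      ≤ α * c.updateProb θ A u' + profileBound p c.σ α := by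
  obtain ⟨T, hT, hT1, h0, h2⟩ := c.exists_updateProb_test hC θ hA hu
  rw [h0, h2, ← lintegral_mixtureOfGaussians, profileBound, if_pos hα]
  simpa using lintegral_le_of_hockeyStick (P := mixtureOfGaussians ![0, 2] ![1 - p, p] c.σ)
    (Q := normal 0 c.σ) α hT hT1

theorem updateProb_le_of_lt_one (hC : 0 < c.C) (θ : c.Theta) {A : Set c.Theta}
    (hA : MeasurableSet A) {u u' : c.Theta} (hu : ‖u - u'‖ ≤ 2 * c.C) (p : ℝ) {α : ℝ≥0}
    (hα : α < 1) :
    c.updateProb θ A u' ≤ α * (ENNReal.ofReal (1 - p) * c.updateProb θ A u'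
        + ENNReal.ofReal p * c.updateProb θ A u) + profileBound p c.σ α := by
  obtain ⟨T, hT, hT1, h0, h2⟩ := c.exists_updateProb_test hC θ hA hu
  rw [h0, h2, ← lintegral_mixtureOfGaussians, profileBound, if_neg (not_le.2 hα)]
  simpa using lintegral_le_of_hockeyStick (P := normal 0 c.σ)
    (Q := mixtureOfGaussians ![0, 2] ![1 - p, p] c.σ) α hT hT1

/-- Both laws have mass one, so the constant `s` can be subtracted from `ψ`, leaving a test bounded
by `S - s`. -/
theorem lintegral_windowLaw_le_oscillation {a a' : Fin c.L → ℝ} {i : Fin c.L}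
    (h : ∀ j, j ≠ i → a j = a' j) (hv : ∀ j, |a j - a' j| ≤ c.v)
    {ψ : c.AugNoise → ℝ≥0∞} (hψ : Measurable ψ) {s S : ℝ≥0∞} (hs : ∀ z, s ≤ ψ z)
    (hS : ∀ z, ψ z ≤ S) :
    ∫⁻ e, ψ e ∂(c.windowLaw a) ≤ ∫⁻ e, ψ e ∂(c.windowLaw a') + (S - s) * c.windowTV := by
  have hsplit : ∀ b : Fin c.L → ℝ, ∫⁻ e, ψ e ∂(c.windowLaw b)
      = s + ∫⁻ e, (ψ e - s) ∂(c.windowLaw b) := by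
    intro b
    calc _ = ∫⁻ e, (s + (ψ e - s)) ∂(c.windowLaw b) :=
          lintegral_congr fun e => (add_tsub_cancel_of_le (hs e)).symm
      _ = _ := by rw [lintegral_add_left measurable_const]; simp
  rw [hsplit a, hsplit a', add_assoc]
  gcongr
  exact c.lintegral_windowLaw_le h hv (hψ.sub_const s) fun z => tsub_le_tsub_right (hS z) s

variable {c}

/-- A swap within the batch only reorders the sum; a swap with a position outside replaces the entry
of `i₀`. In both cases the sum over the other slots is the same. -/
theorem sum_slot_swap {V : Type*} [AddCommMonoid V] {i₀ : Fin c.N} (h₀ : (i₀ : ℕ) < c.topSize)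
    (f : Fin c.N → V) (π : Equiv.Perm (Fin c.N)) (k : Fin c.N) :
    ∑ i : c.Slot, f ((π * Equiv.swap i₀ k) i)
      = f (π (if (k : ℕ) < c.topSize then i₀ else k))
        + ∑ i ∈ Finset.univ.erase (⟨i₀, h₀⟩ : c.Slot), f (π i) := by
  split_ifs with hk
  · rw [Finset.add_sum_erase Finset.univ (fun i : c.Slot => f (π i)) (Finset.mem_univ ⟨i₀, h₀⟩)]
    refine Eq.trans (Finset.sum_congr rfl fun i _ => ?_) (Equiv.sum_comp
      (Equiv.swap (⟨i₀, h₀⟩ : c.Slot) ⟨k, hk⟩) fun i : c.Slot => f (π i))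
    rw [Equiv.Perm.mul_apply]
    congr 2
    simp only [Equiv.swap_apply_def, Subtype.ext_iff]
    split_ifs <;> rfl
  · rw [← Finset.add_sum_erase Finset.univ _ (Finset.mem_univ ⟨i₀, h₀⟩)]
    congr 1
    · simp
    · refine Finset.sum_congr rfl fun i hi => ?_
      have h1 : (i : Fin c.N) ≠ i₀ := fun h => Finset.ne_of_mem_erase hi (Subtype.ext h)
      have h2 : (i : Fin c.N) ≠ k := fun h => hk (h ▸ i.2)
      rw [Equiv.Perm.mul_apply, Equiv.swap_apply_of_ne_of_ne h1 h2]

theorem card_filter_lt_topSize (hle : c.topSize ≤ c.N) :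
    (Finset.univ.filter fun k : Fin c.N => (k : ℕ) < c.topSize).card = c.topSize := by
  rw [Fin.card_filter_val_lt, min_eq_right hle]

/-- Privacy bound for the batches obtained from one another by exchanging series `n`, which sits
in slot `i₀` of `π`, given the windows `y` of all other series. -/
theorem sum_lintegral_swap_le (hC : 0 < c.C) {g : c.AugNoise → c.Theta} (hg : Measurable g)
    (θ : c.Theta) {A : Set c.Theta} (hA : MeasurableSet A) (hle : c.topSize ≤ c.N) {p : ℝ}
    (hp : p ∈ Set.Icc (0 : ℝ) 1)
    (hpTV : ENNReal.ofReal p = (c.N : ℝ≥0∞)⁻¹ * (c.topSize * c.windowTV))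
    {a a' : Fin c.L → ℝ} {i : Fin c.L} (h : ∀ j, j ≠ i → a j = a' j)
    (hv : ∀ j, |a j - a' j| ≤ c.v) {i₀ n : Fin c.N} (h₀ : (i₀ : ℕ) < c.topSize)
    {π : Equiv.Perm (Fin c.N)} (hπ : π i₀ = n) (y : Fin c.N → c.AugNoise) (α : ℝ≥0) :
    ∑ k, ∫⁻ u, c.updateProb θ A (∑ m : c.Slot,
        clip c.C (g (Function.update y n u ((π * Equiv.swap i₀ k) m)))) ∂(c.windowLaw a)
      ≤ α * ∑ k, ∫⁻ u, c.updateProb θ A (∑ m : c.Slot,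
          clip c.C (g (Function.update y n u ((π * Equiv.swap i₀ k) m)))) ∂(c.windowLaw a')
        + c.N * profileBound p c.σ α := by
  have hclip := measurable_clip (D := c.D) c.C
  have hU := c.measurable_updateProb θ hA
  set R : c.Theta := ∑ m ∈ Finset.univ.erase (⟨i₀, h₀⟩ : c.Slot), clip c.C (g (y (π m)))
  have hsum : ∀ k u, ∑ m : c.Slot,
      clip c.C (g (Function.update y n u ((π * Equiv.swap i₀ k) m)))
      = clip c.C (g (if (k : ℕ) < c.topSize then u else y (π k))) + R := by
    intro k u
    rw [sum_slot_swap h₀ (fun m => clip c.C (g (Function.update y n u m)))]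
    congr 1
    · split_ifs with hk
      · rw [hπ, Function.update_self]
      · rw [Function.update_of_ne]
        rintro rfl
        exact hk (π.injective hπ ▸ h₀)
    · refine Finset.sum_congr rfl fun m hm => ?_
      rw [Function.update_of_ne]
      rintro rfl
      exact Finset.ne_of_mem_erase hm (Subtype.ext (π.injective hπ).symm)
  simp only [hsum]
  -- The extrema range over the whole ball, which contains every clipped gradient. They therefore
  -- depend on neither `k` nor the dataset.
  let I : Type := {w : c.Theta // ‖w‖ ≤ c.C}
  have : Nonempty I := ⟨⟨0, by simp⟩⟩
  let H : I → ℝ≥0∞ := fun w => c.updateProb θ A (w.1 + R)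
  have hdist : ∀ w w' : I, ‖(w.1 + R) - (w'.1 + R)‖ ≤ 2 * c.C := fun w w' => by
    rw [add_sub_add_right_eq_sub, two_mul]
    exact (norm_sub_le _ _).trans (add_le_add w.2 w'.2)
  have hinf : ∀ v, ⨅ w, H w ≤ c.updateProb θ A (clip c.C v + R) := fun v =>
    iInf_le H ⟨clip c.C v, norm_clip_le hC v⟩
  have hsup : ∀ v, c.updateProb θ A (clip c.C v + R) ≤ ⨆ w, H w := fun v =>
    le_iSup H ⟨clip c.C v, norm_clip_le hC v⟩
  set G : Fin c.N → (Fin c.L → ℝ) → ℝ≥0∞ := fun k b => ∫⁻ u, c.updateProb θ A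
    (clip c.C (g (if (k : ℕ) < c.topSize then u else y (π k))) + R) ∂(c.windowLaw b) with hG
  have hGsup : ∀ k b, G k b ≤ ⨆ w, H w := fun k b =>
    (lintegral_mono fun u => hsup _).trans (by simp)
  have hGinf : ∀ k b, ⨅ w, H w ≤ G k b := fun k b =>
    le_trans (by simp) (lintegral_mono (f := fun _ => ⨅ w, H w) fun u => hinf _)
  -- For `k` outside the batch the changed series is not used, so its law is irrelevant.
  have hGosc : ∀ k, G k a ≤ G k a' + if (k : ℕ) < c.topSize then
      ((⨆ w, H w) - ⨅ w, H w) * c.windowTV else 0 := by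
    intro k
    by_cases hk : (k : ℕ) < c.topSize
    · simp only [hG, if_pos hk]
      exact c.lintegral_windowLaw_le_oscillation h hv (by fun_prop) (fun z => hinf _)
        fun z => hsup _
    · simp only [hG, if_neg hk]
      simp
  have hN0 : (c.N : ℝ≥0∞) ≠ 0 := by
    have := i₀.pos
    simp; omega
  have hNt : (c.N : ℝ≥0∞) ≠ ⊤ := ENNReal.natCast_ne_top _
  have havg : ∀ x : ℝ≥0∞, (c.N : ℝ≥0∞)⁻¹ * (c.N * x) = x := fun x => by
    rw [← mul_assoc, ENNReal.inv_mul_cancel hN0 hNt, one_mul]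
  have hH1 : ∀ w, H w ≤ 1 := fun w => c.updateProb_le_one θ A _
  have hupper : ∀ b, (c.N : ℝ≥0∞)⁻¹ * ∑ k, G k b ≤ ⨆ w, H w := by
    intro b
    rw [← havg (⨆ w, H w)]
    gcongr
    exact (Finset.sum_le_sum fun k _ => hGsup k b).trans (by simp)
  have hlower : ∀ b, ⨅ w, H w ≤ (c.N : ℝ≥0∞)⁻¹ * ∑ k, G k b := by
    intro b
    rw [← havg (⨅ w, H w)]
    gcongr
    exact le_trans (by simp) (Finset.sum_le_sum (f := fun _ => ⨅ w, H w) fun k _ => hGinf k b)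
  have key := le_mul_add_of_oscillation hH1 hp (α := α) (ε := profileBound p c.σ α)
    (Φ := (c.N : ℝ≥0∞)⁻¹ * ∑ k, G k a) (Φ' := (c.N : ℝ≥0∞)⁻¹ * ∑ k, G k a')
    (fun hα w w' => c.updateProb_le_of_one_le hC θ hA (hdist w w') p hα)
    (fun hα w w' => c.updateProb_le_of_lt_one hC θ hA (hdist w' w) p hα)
    (hupper a) (hlower a') ((hupper a').trans (iSup_le hH1)) ?_
  · calc ∑ k, G k a = c.N * ((c.N : ℝ≥0∞)⁻¹ * ∑ k, G k a) := by
          rw [← mul_assoc, ENNReal.mul_inv_cancel hN0 hNt, one_mul]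
      _ ≤ c.N * (α * ((c.N : ℝ≥0∞)⁻¹ * ∑ k, G k a') + profileBound p c.σ α) := by gcongr
      _ = α * (c.N * (c.N : ℝ≥0∞)⁻¹ * ∑ k, G k a') + c.N * profileBound p c.σ α := by ring
      _ = _ := by rw [ENNReal.mul_inv_cancel hN0 hNt, one_mul]
  · rw [hpTV, mul_assoc, ← mul_add]
    gcongr
    refine (Finset.sum_le_sum fun k _ => hGosc k).trans ?_
    rw [Finset.sum_add_distrib, ← Finset.sum_filter, Finset.sum_const,
      card_filter_lt_topSize hle, nsmul_eq_mul, mul_assoc, mul_comm (c.windowTV)]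

theorem stepLaw_le (hlam : c.lam = 1) (hC : 0 < c.C)
    {g : (Fin c.L_C → ℝ) × (Fin c.L_F → ℝ) → c.Theta} (hg : Measurable g)
    (θ : c.Theta) {A : Set c.Theta} (hA : MeasurableSet A) (hpos : 0 < c.topSize)
    (hle : c.topSize ≤ c.N) {p : ℝ} (hp : p ∈ Set.Icc (0 : ℝ) 1)
    (hpTV : ENNReal.ofReal p = (c.N : ℝ≥0∞)⁻¹ * (c.topSize * c.windowTV))
    {x x' : Dataset c.N c.L} (hx : EventNeighboring 1 c.v x x') (α : ℝ≥0) :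
    c.stepLaw g θ x A ≤ α * c.stepLaw g θ x' A + profileBound p c.σ α := by
  obtain ⟨n, hn, ⟨i, hi⟩, hv⟩ := hx
  have hi' : ∀ j, j ≠ i → x n j = x' n j := fun j hj => hi j fun hc => hj (by ext; omega)
  have hclip := measurable_clip (D := c.D) c.C
  have hU := c.measurable_updateProb θ hA
  let i₀ : Fin c.N := ⟨0, by omega⟩
  let F : Equiv.Perm (Fin c.N) → (Fin c.N → c.AugNoise) → ℝ≥0∞ := fun π y =>
    c.updateProb θ A (∑ m : c.Slot, clip c.C (g (y (π m))))
  have hF : ∀ π, Measurable (F π) := fun π => by unfold F; fun_prop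
  -- `K` overwrites coordinate `n` of `y` by a fresh draw, so one base law `P`, built from `x`,
  -- serves both datasets.
  let K : (Fin c.L → ℝ) → Equiv.Perm (Fin c.N) → (Fin c.N → c.AugNoise) → ℝ≥0∞ := fun b π y =>
    ∫⁻ u, F π (Function.update y n u) ∂(c.windowLaw b)
  have hK : ∀ b π, Measurable (K b π) := fun b π => by
    refine Measurable.lintegral_prod_right'
      (f := fun q : (Fin c.N → c.AugNoise) × c.AugNoise => F π (Function.update q.1 n q.2)) ?_
    exact (hF π).comp (measurable_update_prod n)
  set P := Measure.pi fun m => c.windowLaw (x m)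
  have hlaw : ∀ z : Dataset c.N c.L, (∀ m, m ≠ n → x m = z m) → c.stepLaw g θ z A
      = (Fintype.card (Equiv.Perm (Fin c.N)) : ℝ≥0∞)⁻¹ *
        ∑ π ∈ Finset.univ.filter (fun π : Equiv.Perm (Fin c.N) => π i₀ = n),
          ∫⁻ y, ∑ k, K (z n) (π * Equiv.swap i₀ k) y ∂P := by
    intro z hz
    have hupd : (fun m => c.windowLaw (z m))
        = Function.update (fun m => c.windowLaw (x m)) n (c.windowLaw (z n)) := by
      ext1 m
      by_cases hm : m = n
      · subst hm; simp
      · simp [hm, hz m hm]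
    rw [c.stepLaw_apply hlam hg θ z hA, hupd]
    congr 1
    have h1 : ∀ π : Equiv.Perm (Fin c.N), ∫⁻ y, F π y ∂(Measure.pi
        (Function.update (fun m => c.windowLaw (x m)) n (c.windowLaw (z n))))
        = ∫⁻ y, K (z n) π y ∂P := fun π => lintegral_pi_update _ n _ (hF π)
    rw [Finset.sum_congr rfl fun π _ => h1 π, sum_perm_eq_sum_swap i₀ n]
    refine Finset.sum_congr rfl fun π _ => ?_
    rw [lintegral_finsetSum _ fun k _ => hK _ _]
  rw [hlaw x fun _ _ => rfl, hlaw x' hn]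
  -- Applied to the constant `1`, the regrouping counts `N` permutations per family, matching the
  -- term `N ε` that each family contributes.
  have hcard := sum_perm_eq_sum_swap (M := ℝ≥0∞) i₀ n fun _ => 1
  simp only [Finset.sum_const, nsmul_eq_mul, mul_one, Finset.card_univ, Fintype.card_fin] at hcard
  have hmain : ∑ π ∈ Finset.univ.filter (fun π : Equiv.Perm (Fin c.N) => π i₀ = n),
        ∫⁻ y, ∑ k, K (x n) (π * Equiv.swap i₀ k) y ∂P
      ≤ α * (∑ π ∈ Finset.univ.filter (fun π : Equiv.Perm (Fin c.N) => π i₀ = n),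
          ∫⁻ y, ∑ k, K (x' n) (π * Equiv.swap i₀ k) y ∂P)
        + Fintype.card (Equiv.Perm (Fin c.N)) * profileBound p c.σ α := by
    rw [hcard, Finset.mul_sum, mul_assoc, ← nsmul_eq_mul, ← Finset.sum_const,
      ← Finset.sum_add_distrib]
    refine Finset.sum_le_sum fun π hπ => ?_
    have hm : Measurable fun y => ∑ k, K (x' n) (π * Equiv.swap i₀ k) y :=
      Finset.measurable_sum _ fun k _ => hK _ _
    calc _ ≤ ∫⁻ y, (α * (∑ k, K (x' n) (π * Equiv.swap i₀ k) y)
            + c.N * profileBound p c.σ α) ∂P :=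
          lintegral_mono fun y => sum_lintegral_swap_le hC hg θ hA hle hp hpTV hi' hv hpos
            (Finset.mem_filter.1 hπ).2 y α
      _ = _ := by
        rw [lintegral_add_right _ measurable_const, lintegral_const_mul _ hm]
        simp
  have h0 : (Fintype.card (Equiv.Perm (Fin c.N)) : ℝ≥0∞) ≠ 0 := by simp
  have ht : (Fintype.card (Equiv.Perm (Fin c.N)) : ℝ≥0∞) ≠ ⊤ := ENNReal.natCast_ne_top _
  refine (mul_le_mul_right hmain _).trans_eq ?_
  rw [mul_add, ← mul_assoc _ _ (profileBound p c.σ α), ENNReal.inv_mul_cancel h0 ht, one_mul,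
    mul_left_comm]

end Params

end DPForecast

/-! ### The subsampling weight and conclusion -/

theorem theoremF1 (c : Params)
    (hlam : c.lam = 1)
    (hLam : 0 < c.Lam) (hLamN : c.Lam ≤ c.N)
    (hlen : 0 < c.L_C + c.L_F) (hL : c.L_C + c.L_F + c.L_F ≤ c.L + 1)
    (hC : 0 < c.C)
    {O : Type*} (f : c.Theta → (Fin c.L_C → ℝ) → O) (loss : O → (Fin c.L_F → ℝ) → ℝ)
    (θ : c.Theta) (hmeas : Measurable (c.lossGradient f loss θ))
    (r ρ φ p₂ : ℝ)
    (hr : r = ((c.L_C : ℝ) + c.L_F) / ((c.L : ℝ) - c.L_F + 1))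
    (hρ : ρ = ((c.Lam / c.lam : ℕ) : ℝ) / c.N)
    (hφ : φ = (c.L_F : ℝ) / ((c.L_C : ℝ) + c.L_F))
    (hp₂ : p₂ = ρ * r * φ * tvd (normal 0 c.σ_F) (normal 1 c.σ_F)
      + ρ * r * (1 - φ) * tvd (normal 0 c.σ_C) (normal 1 c.σ_C)) :
    p₂ ∈ Set.Icc (0 : ℝ) 1 ∧
    ∀ α : ℝ≥0,
      c.privacyProfile f loss θ 1 α ≤
        if 1 ≤ α then
          hockeyStick α (mixtureOfGaussians ![0, 2] ![1 - p₂, p₂] c.σ) (normal 0 c.σ)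
        else
          hockeyStick α (normal 0 c.σ) (mixtureOfGaussians ![0, 2] ![1 - p₂, p₂] c.σ) := by
  have htop : c.topSize = c.Lam := by simp [Params.topSize, hlam]
  have hNpos : 0 < c.N := by omega
  have hN : (0 : ℝ) < c.N := by exact_mod_cast hNpos
  have hlen' : (0 : ℝ) < (c.L_C : ℝ) + c.L_F := by exact_mod_cast hlen
  have hLF : c.L_F ≤ c.L := by omega
  have hT : ((c.T : ℕ) : ℝ) = (c.L : ℝ) - c.L_F + 1 := by
    rw [Params.T, Nat.cast_add, Nat.cast_sub hLF, Nat.cast_one]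
  have hTpos : (0 : ℝ) < (c.T : ℕ) := by exact_mod_cast Nat.succ_pos _
  have htvF := tvd_nonneg (normal 0 c.σ_F) (normal 1 c.σ_F)
  have htvC := tvd_nonneg (normal 0 c.σ_C) (normal 1 c.σ_C)
  -- Here `r φ = L_F / T` and `r (1 - φ) = L_C / T`, so `p₂` is `ρ` times the bound `windowTV`.
  have hp : p₂ = (c.N : ℝ)⁻¹ * (c.topSize * (((c.T : ℕ) : ℝ)⁻¹ *
      (c.L_C * tvd (normal 0 c.σ_C) (normal 1 c.σ_C)
        + c.L_F * tvd (normal 0 c.σ_F) (normal 1 c.σ_F)))) := by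
    rw [hp₂, hr, hρ, hφ, ← hT, Params.topSize]
    field_simp
    ring
  have hp01 : p₂ ∈ Set.Icc (0 : ℝ) 1 := by
    rw [hp]
    refine ⟨by positivity, ?_⟩
    have h1 : ((c.T : ℕ) : ℝ)⁻¹ * (c.L_C * tvd (normal 0 c.σ_C) (normal 1 c.σ_C)
        + c.L_F * tvd (normal 0 c.σ_F) (normal 1 c.σ_F)) ≤ 1 := by
      rw [inv_mul_le_iff₀ hTpos, mul_one]
      -- The length hypothesis says that a full window has at most `T` positions, that is `r ≤ 1`.
      have hle : (c.L_C : ℝ) + c.L_F ≤ (c.T : ℕ) := by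
        have : c.L_C + c.L_F ≤ c.T := by unfold Params.T; omega
        exact_mod_cast this
      refine le_trans ?_ hle
      exact add_le_add (mul_le_of_le_one_right (by positivity) (tvd_le_one _ _))
        (mul_le_of_le_one_right (by positivity) (tvd_le_one _ _))
    rw [inv_mul_le_iff₀ hN, mul_one]
    refine (mul_le_of_le_one_right (by positivity) h1).trans ?_
    rw [htop]
    exact_mod_cast hLamN
  refine ⟨hp01, fun α => ?_⟩
  have hpTV : ENNReal.ofReal p₂ = (c.N : ℝ≥0∞)⁻¹ * (c.topSize * c.windowTV) := by
    rw [hp, Params.windowTV, ENNReal.ofReal_mul (by positivity), ENNReal.ofReal_mul (by positivity),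
      ENNReal.ofReal_mul (by positivity), ENNReal.ofReal_add (by positivity) (by positivity),
      ENNReal.ofReal_mul (by positivity), ENNReal.ofReal_mul (by positivity),
      ENNReal.ofReal_inv_of_pos hN, ENNReal.ofReal_inv_of_pos hTpos]
    simp only [ENNReal.ofReal_natCast]
  refine iSup_le fun x => iSup_le fun x' => iSup_le fun hx => ?_
  have h1 := c.isProbabilityMeasure_stepLaw hmeas θ x
  have h2 := c.isProbabilityMeasure_stepLaw hmeas θ x'
  have h3 := IsFiniteMeasure.toSigmaFinite (c.stepLaw (c.lossGradient f loss θ) θ x)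
  have h4 := IsFiniteMeasure.toSigmaFinite (c.stepLaw (c.lossGradient f loss θ) θ x')
  exact hockeyStick_le_of_forall α fun A hA => Params.stepLaw_le hlam hC hmeas θ hA (by omega)
    (by omega) hp01 hpTV hx α
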